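/- Let $E$ be a finite set. An oriented matroid $N$ on $E$ is given by its set $\mathcal C(N)$ of signed circuits (maps $C:E\to\{+1,-1,0\}$ with support $\underline C$, satisfying the signed circuit axioms). The dual $N^\star$ has as signed circuits the nonzero signed sets of minimal support among those orthogonal to every signed circuit of $N$. A facet of $N$ is a set $E\setminus\underline D$, where $D$ is a positive signed circuit of $N^\star$ (all signs on $\underline D$ are $+1$). Thus a facet of $N^\star$ is a set $E\setminus\underline D$ with $D$ a positive signed circuit of $N^{\star\star}$. A mixed matroid is a pair $\mathbf M=(N_0,A)$ with $N_0$ an oriented matroid on $E$ and $A\subseteq E$ the set of unsigned elements; an oriented matroid is regarded as a mixed matroid with $A=\emptyset$. A positive circuit of $\mathbf M$ is a signed circuit of $N_0$ all of whose signs outside $A$ are $+1$. $\mathbf M$ is totally cyclic if every element of $E$ belongs to the support of a positive circuit of $\mathbf M$. An oriented matroid is coherent with $\mathbf M$ if it is obtained from $N_0$ by reversing the signs of the elements of some $B\subseteq A$. For $P\subseteq E\setminus A$, $\mathbf M$ is $P$-connected if it is totally cyclic and for every $p\in P$ there is a positive circuit $C$ of $\mathbf M$ with $\underline C\cap P=\{p\}$.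 $\mathbf M$ has a $P$-orientation if some oriented matroid coherent with $\mathbf M$ is $P$-connected. **Proposition.** Let $\mathbf M=(N_0,A)$ be a totally cyclic, $P$-connected mixed matroid on $E$, where $P\subseteq E\setminus A$ and $|P|\ge 2$. The following two conditions are equivalent: 1. $\mathbf M$ has a $P$-orientation; 2. there is a totally cyclic oriented matroid $N$ coherent with $\mathbf M$ such that, for every $p\in P$, there is a facet $F$ of $N^\star$ that contains $P\setminus\{p\}$ and does not contain $p$ (that is, $F\cap P=P\setminus\{p\}$). -/

import Mathlib

/-- A signed set on the ground set `E`: a map `E → {+1, -1, 0}`. -/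
abbrev SignedSet (E : Type*) := E → SignType

namespace SignedSet

variable {E : Type*}

/-- The underlying set of a signed set. -/
def supp (X : SignedSet E) : Set E := {e | X e ≠ 0}

/-- All signs occurring in `X` outside the set `A` are `+1`. -/
def PositiveOff (A : Set E) (X : SignedSet E) : Prop :=
  ∀ e, e ∈ X.supp \ A → X e = 1

/-- All signs occurring in `X` are `+1`. -/
def Positive (X : SignedSet E) : Prop := ∀ e, e ∈ X.supp → X e = 1

/-- Orthogonality of signed sets: either the supports are disjoint, or there are two elements
of the common support on which the signs agree and disagree, respectively. -/
def Orthogonal (X Y : SignedSet E) : Prop :=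
  (∀ e, X e * Y e = 0) ∨ ∃ e f, X e * Y e = 1 ∧ X f * Y f = -1

open Classical in
/-- Reversal of the signs of a signed set on `B`. -/
noncomputable def reorient (B : Set E) (X : SignedSet E) : SignedSet E :=
  fun e => if e ∈ B then -X e else X e

end SignedSet

/-- An oriented matroid on the ground set `E`, given by its signed circuits
(signed circuit axioms with weak elimination). -/
structure OrientedMatroid (E : Type*) where
  /-- The set of signed circuits. -/
  circuits : Set (SignedSet E)
  zero_notMem : (0 : SignedSet E) ∉ circuits
  neg_mem : ∀ X ∈ circuits, -X ∈ circuits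
  incomparable : ∀ X ∈ circuits, ∀ Y ∈ circuits, X.supp ⊆ Y.supp → X = Y ∨ X = -Y
  elimination : ∀ X ∈ circuits, ∀ Y ∈ circuits, X ≠ -Y → ∀ e, X e = 1 → Y e = -1 →
    ∃ Z ∈ circuits, Z e = 0 ∧ (∀ f, Z f = 1 → X f = 1 ∨ Y f = 1) ∧
      (∀ f, Z f = -1 → X f = -1 ∨ Y f = -1)

/-- If `𝒞` is the set of signed circuits of an oriented matroid `M`, then `dualCircuits 𝒞` is the
set of signed circuits of the dual `M⋆` (the signed cocircuits of `M`): the nonzero signed sets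
orthogonal to all members of `𝒞`, with support minimal among these. -/
def dualCircuits {E : Type*} (𝒞 : Set (SignedSet E)) : Set (SignedSet E) :=
  {Y | (Y ≠ 0 ∧ ∀ X ∈ 𝒞, X.Orthogonal Y) ∧
    ∀ Z : SignedSet E, (Z ≠ 0 ∧ ∀ X ∈ 𝒞, X.Orthogonal Z) → Z.supp ⊆ Y.supp → Z.supp = Y.supp}

/-- `F` is a facet of the oriented matroid with set of signed circuits `𝒞`: the complement of a
positive signed cocircuit. -/
def IsFacet {E : Type*} (𝒞 : Set (SignedSet E)) (F : Set E) : Prop :=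
  ∃ D ∈ dualCircuits 𝒞, D.Positive ∧ F = (D.supp)ᶜ

namespace SignedSet

variable {E : Type*}

theorem reorient_apply_eq_zero (B : Set E) (X : SignedSet E) (e : E) :
    X.reorient B e = 0 ↔ X e = 0 := by
  unfold reorient
  split_ifs <;> simp

theorem supp_reorient (B : Set E) (X : SignedSet E) : (X.reorient B).supp = X.supp := by
  ext e
  exact not_congr (reorient_apply_eq_zero B X e)

theorem reorient_neg (B : Set E) (X : SignedSet E) : (-X).reorient B = -(X.reorient B) := by
  funext e
  by_cases h : e ∈ B <;> simp [reorient, h]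

end SignedSet

namespace OrientedMatroid

variable {E : Type*}

/-- The reorientation of `M` over `B`: reverse the signs of the elements of `B` in all signed
circuits. -/
noncomputable def reorient (M : OrientedMatroid E) (B : Set E) : OrientedMatroid E where
  circuits := SignedSet.reorient B '' M.circuits
  zero_notMem := by
    rintro ⟨X, hX, h⟩
    have : X = 0 := by
      funext e
      exact (SignedSet.reorient_apply_eq_zero B X e).1 (congrFun h e)
    exact M.zero_notMem (this ▸ hX)
  neg_mem := by
    rintro _ ⟨X, hX, rfl⟩
    exact ⟨-X, M.neg_mem X hX, SignedSet.reorient_neg B X⟩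
  incomparable := by
    rintro _ ⟨X, hX, rfl⟩ _ ⟨Y, hY, rfl⟩ h
    rw [SignedSet.supp_reorient, SignedSet.supp_reorient] at h
    rcases M.incomparable X hX Y hY h with rfl | rfl
    · exact Or.inl rfl
    · exact Or.inr (SignedSet.reorient_neg B Y)
  elimination := by
    rintro _ ⟨X, hX, rfl⟩ _ ⟨Y, hY, rfl⟩ hne e he he'
    have hXY : X ≠ -Y := by
      rintro rfl
      exact hne (SignedSet.reorient_neg B Y)
    have key : ∃ Z ∈ M.circuits, Z e = 0 ∧ (∀ f, Z f = 1 → X f = 1 ∨ Y f = 1) ∧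
        (∀ f, Z f = -1 → X f = -1 ∨ Y f = -1) := by
      by_cases h : e ∈ B
      · simp only [SignedSet.reorient, h, if_true] at he he'
        have h1 : Y e = 1 := neg_injective he'
        have h2 : X e = -1 := by rw [← he, neg_neg]
        obtain ⟨Z, hZ, h0, hp, hn⟩ := M.elimination Y hY X hX
          (fun h => hXY (by rw [h, neg_neg])) e h1 h2
        exact ⟨Z, hZ, h0, fun f hf => (hp f hf).symm, fun f hf => (hn f hf).symm⟩
      · simp only [SignedSet.reorient, h, if_false] at he he'
        exact M.elimination X hX Y hY hXY e he he'
    obtain ⟨Z, hZ, h0, hp, hn⟩ := key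
    refine ⟨_, ⟨Z, hZ, rfl⟩, (SignedSet.reorient_apply_eq_zero B Z e).2 h0, ?_, ?_⟩
    · intro f hf
      by_cases h : f ∈ B
      · simp only [SignedSet.reorient, h, if_true] at hf ⊢
        rcases hn f (by rw [← hf, neg_neg]) with h' | h' <;> simp [h']
      · simp only [SignedSet.reorient, h, if_false] at hf ⊢
        exact hp f hf
    · intro f hf
      by_cases h : f ∈ B
      · simp only [SignedSet.reorient, h, if_true] at hf ⊢
        rcases hp f (neg_injective hf) with h' | h' <;> simp [h']
      · simp only [SignedSet.reorient, h, if_false] at hf ⊢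
        exact hn f hf

end OrientedMatroid

/-- A mixed matroid: an oriented matroid together with a set `A` of elements whose signs are
forgotten (the unsigned elements). -/
structure MixedMatroid (E : Type*) where
  /-- The oriented matroid. -/
  om : OrientedMatroid E
  /-- The set of unsigned elements. -/
  A : Set E

/-- An oriented matroid seen as a mixed matroid without unsigned elements. -/
def OrientedMatroid.toMixed {E : Type*} (N : OrientedMatroid E) : MixedMatroid E := ⟨N, ∅⟩

namespace MixedMatroid

variable {E : Type*}

/-- `C` is (a signed circuit of the underlying oriented matroid representing) a positive circuit of
the mixed matroid `M`: all its signs outside `M.A` are `+1`. The signs on `M.A` play no role, but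
the elements of `C` in `M.A` still count as elements of the circuit. -/
def IsPositiveCircuit (M : MixedMatroid E) (C : SignedSet E) : Prop :=
  C ∈ M.om.circuits ∧ C.PositiveOff M.A

/-- Every element lies in a positive circuit. -/
def TotallyCyclic (M : MixedMatroid E) : Prop :=
  ∀ e : E, ∃ C, M.IsPositiveCircuit C ∧ e ∈ C.supp

/-- `P`-connectivity, for a set `P` of signed elements. -/
def PConnected (M : MixedMatroid E) (P : Set E) : Prop :=
  (∀ p ∈ P, ∃ C, M.IsPositiveCircuit C ∧ C.supp ∩ P = {p}) ∧ M.TotallyCyclic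

/-- `N` is coherent with `M`: it is a reorientation of `M.om` over some set of unsigned elements. -/
def Coherent (M : MixedMatroid E) (N : OrientedMatroid E) : Prop :=
  ∃ B : Set E, B ⊆ M.A ∧ N = M.om.reorient B

/-- `M` has a `P`-orientation. -/
def HasPOrientation (M : MixedMatroid E) (P : Set E) : Prop :=
  ∃ N : OrientedMatroid E, M.Coherent N ∧ N.toMixed.PConnected P

end MixedMatroid

/-! ### Orthogonality of signed sets. -/

namespace SignedSet

variable {E : Type*}

/-! Once `N⋆⋆ = N` is known, a facet of `N⋆` is the complement of a positive circuit `C` of `N`, and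
it meets `P` in `P \ {p}` exactly when `C` meets `P` in `{p}`. The two conditions then agree for
each coherent `N` separately, so the weight lies on `dualCircuits_dualCircuits`.

Biduality needs enough cocircuits: each element `f` of an independent set `S` lies in a cocircuit
meeting `S` only in `f`. Hence a nonzero signed set orthogonal to all cocircuits has dependent
support, and on the support of a circuit two-element intersections with cocircuits fix its signs up
to a global one.

Such a cocircuit is read off from the fundamental circuits of a basis. That it is orthogonal to
every circuit is the hard step, `Indep.eq_zero_of_nonneg`, a double induction driven by circuit
elimination. -/

theorem mem_supp {X : SignedSet E} {e : E} : e ∈ X.supp ↔ X e ≠ 0 := Iff.rfl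

theorem supp_neg (X : SignedSet E) : (-X).supp = X.supp := by
  ext e
  simp [supp]

theorem Orthogonal.symm {X Y : SignedSet E} (h : X.Orthogonal Y) : Y.Orthogonal X := by
  simpa only [Orthogonal, mul_comm] using h

/-- Orthogonal signed sets never have exactly one element in common. -/
theorem Orthogonal.exists_ne {X Y : SignedSet E} (h : X.Orthogonal Y) {e : E}
    (hX : X e ≠ 0) (hY : Y e ≠ 0) : ∃ g, g ≠ e ∧ X g ≠ 0 ∧ Y g ≠ 0 := by
  rcases h with h | ⟨a, b, ha, hb⟩
  · exact absurd (h e) (mul_ne_zero hX hY)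
  · have ha0 : X a * Y a ≠ 0 := by rw [ha]; decide
    have hb0 : X b * Y b ≠ 0 := by rw [hb]; decide
    by_cases hae : a = e
    · refine ⟨b, ?_, left_ne_zero_of_mul hb0, right_ne_zero_of_mul hb0⟩
      rintro rfl
      rw [hae, hb] at ha
      exact absurd ha (by decide)
    · exact ⟨a, hae, left_ne_zero_of_mul ha0, right_ne_zero_of_mul ha0⟩

/-- If two orthogonal signed sets have only `e` and `f` in common, then their products of signs
at `e` and at `f` are opposite. -/
theorem Orthogonal.mul_eq_neg {X Y : SignedSet E} (h : X.Orthogonal Y) {e f : E} (hef : e ≠ f)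
    (hcommon : ∀ g, X g ≠ 0 → Y g ≠ 0 → g = e ∨ g = f) : X e * Y e = -(X f * Y f) := by
  rcases h with h | ⟨a, b, ha, hb⟩
  · simp [h]
  · have key : ∀ g, X g * Y g ≠ 0 → g = e ∨ g = f := fun g hg =>
      hcommon g (left_ne_zero_of_mul hg) (right_ne_zero_of_mul hg)
    rcases key a (by rw [ha]; decide) with rfl | rfl <;>
      rcases key b (by rw [hb]; decide) with rfl | rfl
    · rw [ha] at hb; exact absurd hb (by decide)
    · rw [ha, hb]; decide
    · rw [ha, hb]
    · rw [ha] at hb; exact absurd hb (by decide)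

end SignedSet

/-! ### Circuit elimination. -/

namespace OrientedMatroid

open SignedSet

variable {E : Type*} (N : OrientedMatroid E)

theorem supp_eq_of_subset {X Y : SignedSet E} (hX : X ∈ N.circuits) (hY : Y ∈ N.circuits)
    (h : X.supp ⊆ Y.supp) : X.supp = Y.supp := by
  rcases N.incomparable X hX Y hY h with rfl | rfl
  · rfl
  · exact supp_neg Y

/-- Circuit supports form an antichain. The element `g` found here is what makes the unions or
differences in the later inductions shrink. -/
theorem exists_mem_of_notMem {X Z : SignedSet E} (hX : X ∈ N.circuits) (hZ : Z ∈ N.circuits)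
    {e : E} (heX : X e ≠ 0) (heZ : Z e = 0) : ∃ g, Z g ≠ 0 ∧ X g = 0 := by
  by_contra! h
  have hs : e ∈ Z.supp := by
    rw [N.supp_eq_of_subset hZ hX h]
    exact heX
  exact hs heZ

/-- Weak elimination, symmetric in the sign of the eliminated element. -/
theorem weak_elimination {X Y : SignedSet E} (hX : X ∈ N.circuits) (hY : Y ∈ N.circuits)
    (hne : X ≠ -Y) {e : E} (he0 : X e ≠ 0) (he : Y e = -X e) :
    ∃ Z ∈ N.circuits, Z e = 0 ∧ ∀ g, Z g ≠ 0 → Z g = X g ∨ Z g = Y g := by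
  have key : ∃ Z ∈ N.circuits, Z e = 0 ∧ (∀ f, Z f = 1 → X f = 1 ∨ Y f = 1) ∧
      (∀ f, Z f = -1 → X f = -1 ∨ Y f = -1) := by
    rcases SignType.trichotomy (X e) with h | h | h
    · obtain ⟨Z, hZ, h0, hp, hn⟩ := N.elimination Y hY X hX
        (fun h' => hne (by rw [h', neg_neg])) e (by rw [he, h]; decide) h
      exact ⟨Z, hZ, h0, fun f hf => (hp f hf).symm, fun f hf => (hn f hf).symm⟩
    · exact absurd h he0
    · exact N.elimination X hX Y hY hne e h (by rw [he, h])
  obtain ⟨Z, hZ, h0, hp, hn⟩ := key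
  refine ⟨Z, hZ, h0, fun g hg => ?_⟩
  rcases SignType.trichotomy (Z g) with h | h | h
  · rw [h]
    exact (hn g h).imp Eq.symm Eq.symm
  · exact absurd h hg
  · rw [h]
    exact (hp g h).imp Eq.symm Eq.symm

/-- Weak elimination where the second circuit may be replaced by its opposite. -/
theorem weak_elimination_or_neg {X Y : SignedSet E} (hX : X ∈ N.circuits) (hY : Y ∈ N.circuits)
    {e : E} (heX : X e ≠ 0) (heY : Y e ≠ 0) (hne : X.supp ≠ Y.supp) :
    ∃ Z ∈ N.circuits, Z e = 0 ∧ ∀ g, Z g ≠ 0 → Z g = X g ∨ Y g ≠ 0 := by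
  have key : Y e = -X e ∨ (-Y) e = -X e := by
    rw [Pi.neg_apply]
    revert heX heY
    generalize X e = a
    generalize Y e = b
    revert a b
    decide
  rcases key with h | h
  · obtain ⟨Z, hZ, h0, hs⟩ := N.weak_elimination hX hY
      (by rintro rfl; exact hne (supp_neg Y)) heX h
    exact ⟨Z, hZ, h0, fun g hg => (hs g hg).imp_right fun h => by rwa [h] at hg⟩
  · obtain ⟨Z, hZ, h0, hs⟩ := N.weak_elimination hX (N.neg_mem Y hY)
      (by rintro rfl; exact hne (by rw [neg_neg])) heX h
    refine ⟨Z, hZ, h0, fun g hg => (hs g hg).imp_right fun h hY0 => hg ?_⟩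
    rw [h, Pi.neg_apply, hY0, neg_zero]

variable [Finite E]

/-- Strong circuit elimination for the underlying matroid. -/
theorem strong_elimination_supp {X Y : SignedSet E} (hX : X ∈ N.circuits) (hY : Y ∈ N.circuits)
    {e f : E} (heX : X e ≠ 0) (heY : Y e ≠ 0) (hfX : X f ≠ 0) (hfY : Y f = 0) :
    ∃ Z ∈ N.circuits, Z e = 0 ∧ Z f ≠ 0 ∧ ∀ g, Z g ≠ 0 → X g ≠ 0 ∨ Y g ≠ 0 := by
  induction hn : (X.supp ∪ Y.supp).ncard using Nat.strong_induction_on generalizing X Y e f with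
  | _ n ih =>
    subst hn
    obtain ⟨Z, hZ, hZe, hZs⟩ := N.weak_elimination_or_neg hX hY heX heY
      (fun h => (h ▸ hfX : f ∈ Y.supp) hfY)
    have hZs' : ∀ g, Z g ≠ 0 → X g ≠ 0 ∨ Y g ≠ 0 := fun g hg =>
      (hZs g hg).imp_left fun h => by rwa [h] at hg
    by_cases hZf : Z f = 0
    -- `Z` has lost `f`. Replace `Y` by a circuit `Y'` inside `Y ∪ Z` that keeps `e` but avoids `g`,
    -- then eliminate `e` between `X` and `Y'`. The two unions are smaller since they miss `f` and
    -- `g` respectively.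
    · obtain ⟨g, hgZ, hgX⟩ := N.exists_mem_of_notMem hX hZ heX hZe
      have hgY : Y g ≠ 0 := (hZs' g hgZ).resolve_left fun h => h hgX
      obtain ⟨Y', hY', hY'g, hY'e, hY's⟩ := ih _ (Set.ncard_lt_ncard (Set.ssubset_iff_exists.2
        ⟨by
          rintro a (ha | ha)
          · exact Or.inr ha
          · exact hZs' a ha, f, Or.inl hfX, by
          rintro (ha | ha)
          · exact ha hfY
          · exact ha hZf⟩)) hY hZ hgY hgZ heY hZe rfl
      have hY'XY : ∀ a, Y' a ≠ 0 → X a ≠ 0 ∨ Y a ≠ 0 := fun a ha =>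
        (hY's a ha).elim Or.inr (hZs' a)
      have hY'f : Y' f = 0 := by
        by_contra h
        exact (hY's f h).elim (fun h => h hfY) (fun h => h hZf)
      obtain ⟨W, hW, hWe, hWf, hWs⟩ := ih _ (Set.ncard_lt_ncard (Set.ssubset_iff_exists.2
        ⟨by
          rintro a (ha | ha)
          · exact Or.inl ha
          · exact hY'XY a ha, g, Or.inr hgY, by
          rintro (ha | ha)
          · exact ha hgX
          · exact ha hY'g⟩)) hX hY' heX hY'e hfX hY'f rfl
      exact ⟨W, hW, hWe, hWf, fun a ha => (hWs a ha).elim Or.inl (hY'XY a)⟩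
    · exact ⟨Z, hZ, hZe, hZf, hZs'⟩

/-- Eliminating an element of a circuit `X` by means of a circuit `Y` disjoint from `D`, without
losing `D` altogether and with the signs of `X` on `D`. -/
theorem elimination_keeping {D : Set E} {X Y : SignedSet E} (hX : X ∈ N.circuits)
    (hY : Y ∈ N.circuits) (hYD : ∀ d ∈ D, Y d = 0) (hXD : ∃ d ∈ D, X d ≠ 0)
    {e : E} (heX : X e ≠ 0) (heY : Y e ≠ 0) :
    ∃ Z ∈ N.circuits, Z e = 0 ∧ (∀ g, Z g ≠ 0 → X g ≠ 0 ∨ Y g ≠ 0) ∧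
      (∀ d ∈ D, Z d ≠ 0 → Z d = X d) ∧ ∃ d ∈ D, Z d ≠ 0 := by
  induction hn : (X.supp ∪ Y.supp).ncard using Nat.strong_induction_on generalizing Y with
  | _ n ih =>
    subst hn
    obtain ⟨d, hdD, hdX⟩ := hXD
    obtain ⟨Z, hZ, hZe, hZs⟩ := N.weak_elimination_or_neg hX hY heX heY
      (fun h => (h ▸ hdX : d ∈ Y.supp) (hYD d hdD))
    have hZs' : ∀ g, Z g ≠ 0 → X g ≠ 0 ∨ Y g ≠ 0 := fun g hg =>
      (hZs g hg).imp_left fun h => by rwa [h] at hg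
    by_cases hZD : ∃ d ∈ D, Z d ≠ 0
    · exact ⟨Z, hZ, hZe, hZs',
        fun d hd hZd => (hZs d hZd).resolve_right fun h => h (hYD d hd), hZD⟩
    · push Not at hZD
      -- `Z` misses `D`, as does `Y`, so a circuit `Y'` inside `Y ∪ Z` through `e` avoiding `g` can
      -- replace `Y`, and `X ∪ Y'` misses `g`.
      obtain ⟨g, hgZ, hgX⟩ := N.exists_mem_of_notMem hX hZ heX hZe
      have hgY : Y g ≠ 0 := (hZs' g hgZ).resolve_left fun h => h hgX
      obtain ⟨Y', hY', hY'g, hY'e, hY's⟩ :=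
        N.strong_elimination_supp hY hZ hgY hgZ heY hZe
      have hY'XY : ∀ a, Y' a ≠ 0 → X a ≠ 0 ∨ Y a ≠ 0 := fun a ha =>
        (hY's a ha).elim Or.inr (hZs' a)
      have hY'D : ∀ d ∈ D, Y' d = 0 := fun d hd => by
        by_contra h
        exact (hY's d h).elim (fun h => h (hYD d hd)) (fun h => h (hZD d hd))
      obtain ⟨W, hW, hWe, hWs, hWD⟩ := ih _ (Set.ncard_lt_ncard (Set.ssubset_iff_exists.2
        ⟨by
          rintro a (ha | ha)
          · exact Or.inl ha
          · exact hY'XY a ha, g, Or.inr hgY, by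
          rintro (ha | ha)
          · exact ha hgX
          · exact ha hY'g⟩)) hY' hY'D hY'e rfl
      exact ⟨W, hW, hWe, fun a ha => (hWs a ha).elim Or.inl (hY'XY a), hWD⟩

/-! ### Independent sets and fundamental cocircuits. -/

/-- A set of elements is independent if it contains the support of no circuit. -/
def Indep (S : Set E) : Prop := ∀ X ∈ N.circuits, ¬ X.supp ⊆ S

variable {N}

/-- If `B` is independent and `f ∈ B`, then `f` is not in the closure of `B \ {f}`: no circuit
contains `f` and otherwise only elements of `B` or elements `e` having a circuit
`Y e ⊆ (B ∪ {e}) \ {f}` through `e`. -/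
theorem Indep.eq_zero_of_fundamental {B : Set E} (hB : N.Indep B) {f : E}
    {Y : E → SignedSet E} {X : SignedSet E} (hX : X ∈ N.circuits)
    (hY : ∀ e ∉ B, X e ≠ 0 → Y e ∈ N.circuits ∧ Y e e ≠ 0 ∧ (Y e).supp ⊆ insert e B ∧ Y e f = 0) :
    f ∈ B → X f = 0 := by
  intro hfB
  by_contra hXf
  induction hn : (X.supp \ B).ncard using Nat.strong_induction_on generalizing X with
  | _ n ih =>
    subst hn
    -- Eliminating `e` with `Y e` keeps `f` and brings in no new element outside `B`.
    obtain ⟨e, heX, heB⟩ := Set.not_subset.1 (hB X hX)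
    obtain ⟨hYc, hYe, hYs, hYf⟩ := hY e heB heX
    obtain ⟨Z, hZ, hZe, hZf, hZs⟩ := N.strong_elimination_supp hX hYc heX hYe hXf hYf
    have hsub : ∀ a ∉ B, Z a ≠ 0 → X a ≠ 0 := fun a haB ha =>
      (hZs a ha).elim id fun h => ((hYs h).resolve_right haB) ▸ heX
    exact ih _ (Set.ncard_lt_ncard (Set.ssubset_iff_exists.2
      ⟨fun a ha => ⟨hsub a ha.2 ha.1, ha.2⟩, e, ⟨heX, heB⟩, fun h => h.1 hZe⟩)) hZ
      (fun a haB ha => hY a haB (hsub a haB ha)) hZf rfl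

/-- The signed set `D` obtained from fundamental circuits `Y e` of an independent set `B` and an
element `f ∈ B` has no circuit `X` on which all products of signs are nonnegative, unless
all of them are zero. -/
theorem Indep.eq_zero_of_nonneg {B : Set E} (hB : N.Indep B) {f : E} (hfB : f ∈ B)
    {Y : E → SignedSet E} {D : SignedSet E}
    (hYc : ∀ e ∉ B, Y e ∈ N.circuits) (hYe : ∀ e ∉ B, Y e e = 1)
    (hYs : ∀ e ∉ B, (Y e).supp ⊆ insert e B) (hDf : D f = 1)
    (hDB : ∀ e ∈ B, e ≠ f → D e = 0) (hD : ∀ e ∉ B, D e = -Y e f)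
    {X : SignedSet E} (hX : X ∈ N.circuits) (hpos : ∀ e, X e * D e ≠ -1) :
    ∀ e, X e * D e = 0 := by
  induction hm : ((X.supp ∩ D.supp) \ {f}).ncard using Nat.strong_induction_on generalizing X with
  | _ m ihm =>
  subst hm
  by_contra! hnz
  obtain ⟨d, hd⟩ := hnz
  by_cases hsub : X.supp ∩ D.supp ⊆ {f}
  -- Here `Y e` avoids `f` for every `e` of `X` outside `B`, which puts `f` in the closure of `B \
  -- {f}`.
  · have hdf : d = f := hsub ⟨left_ne_zero_of_mul hd, right_ne_zero_of_mul hd⟩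
    refine left_ne_zero_of_mul hd (hdf ▸ hB.eq_zero_of_fundamental hX (Y := Y) ?_ hfB)
    intro e heB heX
    refine ⟨hYc e heB, by simp [hYe e heB], hYs e heB, ?_⟩
    by_contra hYf
    have hef : e = f := hsub ⟨heX, by
      rw [mem_supp, hD e heB]
      simpa using hYf⟩
    exact heB (hef ▸ hfB)
  · obtain ⟨e, ⟨heX, heD⟩, hef⟩ := Set.not_subset.1 hsub
    have heB : e ∉ B := fun h => heD (hDB e h hef)
    have hYD : ∀ g, (Y e) g ≠ 0 → D g ≠ 0 → g = e ∨ g = f := fun g hg hDg =>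
      (hYs e heB hg).imp id fun h => by
        by_contra hgf
        exact hDg (hDB g h hgf)
    clear hsub
    -- Inner induction with `e` fixed; the outer one is on the part of `X ∩ D` other than `f`.
    induction hn : (X.supp \ (Y e).supp).ncard using Nat.strong_induction_on generalizing X d with
    | _ n ihn =>
    subst hn
    -- the signed circuit `± Y e` whose sign at `e` is opposite to that of `X`
    obtain ⟨V, hV, hVe, hVY, hVf⟩ : ∃ V ∈ N.circuits, V e = -X e ∧ V.supp = (Y e).supp ∧
        V f * D f = 1 := by
      -- The product of `X` and `D` at `e` is `1`, so that of `V` and `D` is `-1` there; the choice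
      -- `D e = -Y e f` makes it `1` at `f`.
      have h1 := hYe e heB
      have h2 := hD e heB
      have h3 := hpos e
      rw [h2] at h3
      rw [mem_supp, h2] at heD
      rw [mem_supp] at heX
      rw [hDf]
      rcases SignType.trichotomy (X e) with h | h | h
      · refine ⟨Y e, hYc e heB, by rw [h1, h]; decide, rfl, ?_⟩
        rw [h] at h3
        revert h3 heD
        generalize Y e f = a
        revert a
        decide
      · exact absurd h heX
      · refine ⟨-Y e, N.neg_mem _ (hYc e heB), by rw [Pi.neg_apply, h1, h], supp_neg _, ?_⟩
        rw [h] at h3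
        rw [Pi.neg_apply]
        revert h3 heD
        generalize Y e f = a
        revert a
        decide
    have hVs : ∀ g, V g ≠ 0 ↔ Y e g ≠ 0 := fun g => Set.ext_iff.1 hVY g
    have hne : X ≠ -V := by
      intro h
      have h3 := hpos f
      rw [h, Pi.neg_apply, neg_mul, hVf] at h3
      exact h3 rfl
    obtain ⟨Z, hZ, hZe, hZs⟩ := N.weak_elimination hX hV hne heX hVe
    -- The only negative product of `V` and `D` sits at `e`, which `Z` avoids.
    have hZpos : ∀ g, Z g * D g ≠ -1 := by
      intro g hg
      have hg0 : Z g * D g ≠ 0 := by rw [hg]; decide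
      rcases hZs g (left_ne_zero_of_mul hg0) with h | h
      · exact hpos g (h ▸ hg)
      · rcases hYD g ((hVs g).1 (h ▸ left_ne_zero_of_mul hg0)) (right_ne_zero_of_mul hg0)
          with rfl | rfl
        · exact left_ne_zero_of_mul hg0 hZe
        · rw [h, hVf] at hg
          exact absurd hg (by decide)
    have hZX : ∀ g, Z g ≠ 0 → D g ≠ 0 → g ≠ f → X g ≠ 0 := by
      intro g hg hDg hgf
      rcases hZs g hg with h | h
      · exact h ▸ hg
      · rcases hYD g ((hVs g).1 (h ▸ hg)) hDg with rfl | rfl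
        · exact heX
        · exact absurd rfl hgf
    -- By the outer induction `Z` is disjoint from `D`, so it can remove from `X` an element `h`
    -- outside `Y e` without changing signs on `D`.
    have hZ0 := ihm _ (Set.ncard_lt_ncard (Set.ssubset_iff_exists.2
      ⟨fun g hg => ⟨⟨hZX g hg.1.1 hg.1.2 hg.2, hg.1.2⟩, hg.2⟩, e, ⟨⟨heX, heD⟩, hef⟩,
        fun h => h.1.1 hZe⟩)) hZ hZpos rfl
    obtain ⟨h, hhZ, hhY⟩ := N.exists_mem_of_notMem (hYc e heB) hZ
      (show Y e e ≠ 0 by simp [hYe e heB]) hZe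
    have hhX : X h ≠ 0 := by
      rcases hZs h hhZ with h' | h'
      · exact h' ▸ hhZ
      · exact absurd hhY ((hVs h).1 (h' ▸ hhZ))
    obtain ⟨W, hW, hWh, hWs, hWD, d', hd'D, hd'W⟩ := N.elimination_keeping (D := D.supp) hX hZ
      (fun a ha => (mul_eq_zero.1 (hZ0 a)).resolve_right ha)
      ⟨d, right_ne_zero_of_mul hd, left_ne_zero_of_mul hd⟩ hhX hhZ
    have hWpos : ∀ g, W g * D g ≠ -1 := by
      intro g hg
      have hg0 : W g * D g ≠ 0 := by rw [hg]; decide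
      rw [hWD g (right_ne_zero_of_mul hg0) (left_ne_zero_of_mul hg0)] at hg
      exact hpos g hg
    have hWX : (W.supp ∩ D.supp) \ {f} ⊆ (X.supp ∩ D.supp) \ {f} := fun g hg =>
      ⟨⟨by
        rw [mem_supp, ← hWD g hg.1.2 hg.1.1]
        exact hg.1.1, hg.1.2⟩, hg.2⟩
    have hWd' : W d' * D d' ≠ 0 := mul_ne_zero hd'W hd'D
    -- If `W` still meets `D` outside `f` wherever `X` does, it contains `e`, and losing `h` feeds
    -- the inner induction; otherwise the outer one applies.
    rcases hWX.eq_or_ssubset with heq | hss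
    · have heW : e ∈ (W.supp ∩ D.supp) \ {f} := by
        rw [heq]
        exact ⟨⟨heX, heD⟩, hef⟩
      refine ihn _ (Set.ncard_lt_ncard (Set.ssubset_iff_exists.2 ⟨?_, h, ⟨hhX, fun h' => h' hhY⟩,
        fun h' => h'.1 hWh⟩)) hW hWpos (fun k hk => ihm k (heq ▸ hk)) d' hWd' heW.1.1 rfl
      rintro g ⟨hgW, hgY⟩
      refine ⟨(hWs g hgW).elim id fun hgZ => ?_, hgY⟩
      rcases hZs g hgZ with h' | h'
      · exact (h' ▸ hgZ : X g ≠ 0)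
      · exact absurd ((hVs g).1 (h' ▸ hgZ)) hgY
    · exact hWd' (ihm _ (Set.ncard_lt_ncard hss) hW hWpos rfl d')

/-- The fundamental cocircuit of an element `f` of a basis `B`. -/
theorem exists_dualCircuit_inter_basis {B : Set E} (hB : Maximal N.Indep B) {f : E}
    (hfB : f ∈ B) : ∃ D ∈ dualCircuits N.circuits, D f ≠ 0 ∧ ∀ e ∈ B, e ≠ f → D e = 0 := by
  classical
  have hfund : ∀ e, ∃ Y : SignedSet E, e ∉ B → Y ∈ N.circuits ∧ Y e = 1 ∧
      Y.supp ⊆ insert e B := by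
    intro e
    by_cases heB : e ∈ B
    · exact ⟨0, fun h => absurd heB h⟩
    have hdep : ¬ N.Indep (insert e B) := fun h =>
      heB (hB.2 h (Set.subset_insert e B) (Set.mem_insert e B))
    simp only [Indep, not_forall, not_not] at hdep
    obtain ⟨Y, hY, hYs⟩ := hdep
    rcases SignType.trichotomy (Y e) with h | h | h
    · exact ⟨-Y, fun _ => ⟨N.neg_mem Y hY, by rw [Pi.neg_apply, h, neg_neg], by rwa [supp_neg]⟩⟩
    · refine absurd (fun a ha => (hYs ha).resolve_left ?_) (hB.1 Y hY)
      rintro rfl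
      exact ha h
    · exact ⟨Y, fun _ => ⟨hY, h, hYs⟩⟩
  choose Y hY using hfund
  -- With `D f = 1`, these values are forced by orthogonality to the fundamental circuits `Y e`.
  obtain ⟨D, hDf, hDB, hD⟩ : ∃ D : SignedSet E, D f = 1 ∧ (∀ e ∈ B, e ≠ f → D e = 0) ∧
      ∀ e ∉ B, D e = -Y e f := by
    refine ⟨fun e => if e = f then 1 else if e ∈ B then 0 else -Y e f, by simp, ?_, ?_⟩
    · intro e he hef
      simp [he, hef]
    · intro e he
      have hef : e ≠ f := by
        rintro rfl
        exact he hfB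
      simp [he, hef]
  have hzero : ∀ X ∈ N.circuits, (∀ e, X e * D e ≠ -1) → ∀ e, X e * D e = 0 :=
    fun X hX hpos => hB.1.eq_zero_of_nonneg hfB (fun e he => (hY e he).1)
      (fun e he => (hY e he).2.1) (fun e he => (hY e he).2.2) hDf hDB hD hX hpos
  have horth : ∀ X ∈ N.circuits, X.Orthogonal D := by
    intro X hX
    by_cases hneg : ∃ e, X e * D e = -1
    · by_cases hpos : ∃ e, X e * D e = 1
      · obtain ⟨e, he⟩ := hpos
        obtain ⟨g, hg⟩ := hneg
        exact Or.inr ⟨e, g, he, hg⟩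
      -- All products are now nonpositive, so `-X` has nonnegative ones.
      · left
        have h := hzero (-X) (N.neg_mem X hX) fun e he => hpos ⟨e, by
          rw [Pi.neg_apply, neg_mul] at he
          exact neg_injective he⟩
        intro e
        have he := h e
        rw [Pi.neg_apply, neg_mul] at he
        exact neg_injective (he.trans (by decide))
    · exact Or.inl (hzero X hX fun e he => hneg ⟨e, he⟩)
  have hcommon : ∀ e ∉ B, ∀ g, Y e g ≠ 0 → D g ≠ 0 → g = e ∨ g = f := fun e he g hg hDg =>
    ((hY e he).2.2 hg).imp id fun h => by
      by_contra hgf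
      exact hDg (hDB g h hgf)
  refine ⟨D, ⟨⟨fun h => ?_, horth⟩, fun Z ⟨hZ0, hZorth⟩ hZD => hZD.antisymm ?_⟩, ?_, hDB⟩
  · rw [h, Pi.zero_apply] at hDf
    exact absurd hDf (by decide)
  -- Inside `D`, `Z` can meet `Y e` only in `e` and `f`, and orthogonality forbids a single common
  -- element. So `Z` contains `f`, and then every element of `D`.
  · have hZf : Z f ≠ 0 := by
      obtain ⟨e, he⟩ := Function.ne_iff.1 hZ0
      by_cases heB : e ∈ B
      · by_cases hef : e = f
        · exact hef ▸ he
        · exact absurd (hDB e heB hef) (hZD he)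
      · obtain ⟨g, hge, hgY, hgZ⟩ := (hZorth _ (hY e heB).1).exists_ne (e := e)
          (by simp [(hY e heB).2.1]) he
        exact ((hcommon e heB g hgY (hZD hgZ)).resolve_left hge) ▸ hgZ
    intro e he
    by_cases heB : e ∈ B
    · by_cases hef : e = f
      · exact hef ▸ hZf
      · exact absurd (hDB e heB hef) he
    · have hYf : Y e f ≠ 0 := by
        intro h
        rw [mem_supp, hD e heB, h] at he
        exact he rfl
      obtain ⟨g, hgf, hgY, hgZ⟩ := (hZorth _ (hY e heB).1).exists_ne hYf hZf
      exact ((hcommon e heB g hgY (hZD hgZ)).resolve_right hgf) ▸ hgZ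
  · rw [hDf]
    decide

/-- Every element `f` of an independent set `S` is the only element of `S` in some signed
cocircuit. -/
theorem Indep.exists_dualCircuit {S : Set E} (hS : N.Indep S) {f : E} (hf : f ∈ S) :
    ∃ D ∈ dualCircuits N.circuits, D f ≠ 0 ∧ ∀ e ∈ S, e ≠ f → D e = 0 := by
  obtain ⟨B, hSB, hB⟩ := Set.Finite.exists_le_maximal (Set.toFinite {S | N.Indep S}) hS
  obtain ⟨D, hD, hDf, hDB⟩ := exists_dualCircuit_inter_basis hB (hSB hf)
  exact ⟨D, hD, hDf, fun e he => hDB e (hSB he)⟩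

/-! ### Biduality. -/

variable (N)

/-- The dual of the dual of an oriented matroid is the oriented matroid itself. -/
theorem dualCircuits_dualCircuits : dualCircuits (dualCircuits N.circuits) = N.circuits := by
  have horth : ∀ X ∈ N.circuits, X ≠ 0 ∧ ∀ D ∈ dualCircuits N.circuits, D.Orthogonal X :=
    fun X hX => ⟨fun h => N.zero_notMem (h ▸ hX), fun D hD => (hD.1.2 X hX).symm⟩
  have hdep : ∀ Z : SignedSet E, (Z ≠ 0 ∧ ∀ D ∈ dualCircuits N.circuits, D.Orthogonal Z) →
      ∃ X ∈ N.circuits, X.supp ⊆ Z.supp := by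
    rintro Z ⟨hZ0, hZ⟩
    by_contra! hind
    obtain ⟨f, hf⟩ := Function.ne_iff.1 hZ0
    obtain ⟨D, hD, hDf, hDs⟩ := Indep.exists_dualCircuit (N := N) (S := Z.supp) hind hf
    obtain ⟨g, hgf, hgD, hgZ⟩ := (hZ D hD).exists_ne hDf hf
    exact hgD (hDs g hgZ hgf)
  ext Z
  refine ⟨fun ⟨hZ, hmin⟩ => ?_, fun hZ => ⟨horth Z hZ, fun X hX hXZ => ?_⟩⟩
  · obtain ⟨X, hX, hXZ⟩ := hdep Z hZ
    have hs := hmin X (horth X hX) hXZ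
    have hs' : ∀ g, X g ≠ 0 ↔ Z g ≠ 0 := Set.ext_iff.1 hs
    obtain ⟨f, hf⟩ := Function.ne_iff.1 hZ.1
    have hfX : X f ≠ 0 := (hs' f).2 hf
    -- `Z` and `X` are proportional, in a form without division.
    have key : ∀ e, Z e * X f = X e * Z f := by
      intro e
      by_cases he : Z e = 0
      · have : X e = 0 := by
          by_contra h
          exact (hs' e).1 h he
        rw [he, this, zero_mul, zero_mul]
      by_cases hef : e = f
      · rw [hef, mul_comm]
      -- A circuit minus one element is independent, which yields a cocircuit `D` through `f`
      -- meeting `X` at most in `e` and `f`. Orthogonality to `X` and to `Z` then compares their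
      -- signs at these two elements.
      have hind : N.Indep (X.supp \ {e}) := fun X' hX' hsub => by
        have h := N.supp_eq_of_subset hX' hX (hsub.trans Set.sdiff_subset)
        exact (hsub (h ▸ (hs' e).2 he : e ∈ X'.supp)).2 rfl
      obtain ⟨D, hD, hDf, hDs⟩ := hind.exists_dualCircuit (f := f) ⟨hfX, Ne.symm hef⟩
      have hcommon : ∀ g, D g ≠ 0 → X g ≠ 0 → g = e ∨ g = f := fun g hgD hgX => by
        by_contra! h
        exact hgD (hDs g ⟨hgX, h.1⟩ h.2)
      have h1 := ((horth X hX).2 D hD).mul_eq_neg hef hcommon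
      have h2 := (hZ.2 D hD).mul_eq_neg hef fun g hgD hgZ => hcommon g hgD ((hs' g).2 hgZ)
      have hDe : D e ≠ 0 := by
        intro h
        rw [h, zero_mul] at h1
        exact mul_ne_zero hDf hfX (neg_injective (h1.symm.trans (by decide)))
      refine mul_left_cancel₀ (mul_ne_zero hDe hDf) ?_
      calc D e * D f * (Z e * X f) = D e * Z e * (D f * X f) := mul_mul_mul_comm ..
        _ = D f * Z f * (D e * X e) := by rw [h1, h2, neg_mul, mul_neg]
        _ = D e * X e * (D f * Z f) := mul_comm ..
        _ = D e * D f * (X e * Z f) := mul_mul_mul_comm ..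
    have hsign : Z f = X f ∨ Z f = -X f := by
      revert hf hfX
      rw [Pi.zero_apply]
      generalize Z f = a
      generalize X f = b
      revert a b
      decide
    have hZX : Z = X ∨ Z = -X := by
      refine hsign.imp (fun h => funext fun e => ?_) (fun h => funext fun e => ?_)
      · have := key e
        rw [h] at this
        exact mul_right_cancel₀ hfX this
      · have := key e
        rw [h, mul_neg, ← neg_mul] at this
        exact mul_right_cancel₀ hfX this
    rcases hZX with rfl | rfl
    · exact hX
    · exact N.neg_mem X hX
  · obtain ⟨X', hX', hs⟩ := hdep X hX
    exact hXZ.antisymm (N.supp_eq_of_subset hX' hZ (hs.trans hXZ) ▸ hs)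

end OrientedMatroid

/-! ### The proposition. -/

theorem mainTheorem6 {E : Type*} [Finite E] (M : MixedMatroid E) (P : Set E)
    (hPA : Disjoint P M.A) (hcyc : M.TotallyCyclic) (hconn : M.PConnected P)
    (hcard : 2 ≤ P.ncard) :
    M.HasPOrientation P ↔
      ∃ N : OrientedMatroid E, M.Coherent N ∧ N.toMixed.TotallyCyclic ∧
        ∀ p ∈ P, ∃ F : Set E, IsFacet (dualCircuits N.circuits) F ∧
          P \ {p} ⊆ F ∧ p ∉ F := by
  have key : ∀ N : OrientedMatroid E, ∀ p ∈ P,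
      (∃ C, N.toMixed.IsPositiveCircuit C ∧ C.supp ∩ P = {p}) ↔
        ∃ F : Set E, IsFacet (dualCircuits N.circuits) F ∧ P \ {p} ⊆ F ∧ p ∉ F := by
    intro N p hp
    -- By biduality the facets of `N⋆` become complements of positive circuits of `N`.
    simp only [IsFacet, N.dualCircuits_dualCircuits]
    constructor
    · rintro ⟨C, ⟨hC, hpos⟩, hCP⟩
      refine ⟨C.suppᶜ, ⟨C, hC, fun e he => hpos e ⟨he, id⟩, rfl⟩, ?_, ?_⟩
      · rintro q ⟨hq, hqp⟩ hqC
        exact hqp (hCP ▸ ⟨hqC, hq⟩ : q ∈ ({p} : Set E))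
      · have hpC : p ∈ C.supp ∩ P := hCP ▸ rfl
        exact fun h => h hpC.1
    · rintro ⟨_, ⟨C, hC, hpos, rfl⟩, hsub, hpF⟩
      refine ⟨C, ⟨hC, fun e he => hpos e he.1⟩, Set.Subset.antisymm ?_ ?_⟩
      · rintro q ⟨hqC, hq⟩
        by_contra hqp
        exact hsub ⟨hq, hqp⟩ hqC
      · rintro q rfl
        exact ⟨not_not.1 hpF, hp⟩
  constructor
  · rintro ⟨N, hN, hconnN, hcycN⟩
    exact ⟨N, hN, hcycN, fun p hp => (key N p hp).1 (hconnN p hp)⟩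
  · rintro ⟨N, hN, hcycN, hF⟩
    exact ⟨N, hN, fun p hp => (key N p hp).2 (hF p hp), hcycN⟩
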